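/- Let $\mathbb G$ be a compact Lie group equipped with a bi-invariant Riemannian metric, let $\mathcal L$ be its Laplace–Beltrami operator, and let $\mathrm dx$ be the normalized Haar measure on $\mathbb G$. All functions are real-valued. Let $H^1_{\mathcal L}(\mathbb G)=\{f\in L^2(\mathbb G):(-\mathcal L)^{1/2}f\in L^2(\mathbb G)\}$, with norm $\|f\|_{L^2}+\|(-\mathcal L)^{1/2}f\|_{L^2}$, where $(-\mathcal L)^{1/2}$ is defined by the spectral decomposition of $-\mathcal L$. Let $p,q>1$, $b>0$ and $b^2\ge 4m^2>0$. For $\varepsilon>0$ consider the weakly coupled system $$\begin{cases}\partial_t^2u-\mathcal Lu+b\,\partial_tu+m^2u=|v|^p,& x\in\mathbb G,\ t>0,\\ \partial_t^2v-\mathcal Lv=|u|^q,& x\in\mathbb G,\ t>0,\\ (u,\partial_tu)(0,x)=\varepsilon(u_0,u_1)(x),\quad (v,\partial_tv)(0,x)=\varepsilon(v_0,v_1)(x),& x\in\mathbb G.\end{cases}$$ For $T>0$, a pair $(u,v)$ is an *energy solution on $[0,T)$* if $$u\in C([0,T),H^1_{\mathcal L}(\mathbb G))\cap C^1([0,T),L^2(\mathbb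 G))\cap L^q_{\mathrm{loc}}([0,T)\times\mathbb G),\quad v\in C([0,T),H^1_{\mathcal L}(\mathbb G))\cap C^1([0,T),L^2(\mathbb G))\cap L^p_{\mathrm{loc}}([0,T)\times\mathbb G),$$ and, for all $\psi,\varphi\in C_0^\infty([0,T)\times\mathbb G)$ and all $t\in(0,T)$, $$\begin{aligned}\int_0^t\!\!\int_{\mathbb G}|v|^p\psi\,\mathrm dx\,\mathrm ds={}&\int_{\mathbb G}\big(\partial_tu(t,x)\psi(t,x)-u(t,x)\partial_s\psi(t,x)+b\,u(t,x)\psi(t,x)\big)\mathrm dx\\&-\varepsilon\int_{\mathbb G}\big(u_1(x)\psi(0,x)-u_0(x)\partial_s\psi(0,x)+b\,u_0(x)\psi(0,x)\big)\mathrm dx\\&+\int_0^t\!\!\int_{\mathbb G}u\,\big(\partial_s^2\psi-\mathcal L\psi-b\,\partial_s\psi+m^2\psi\big)\mathrm dx\,\mathrm ds,\\ \int_0^t\!\!\int_{\mathbb G}|u|^q\varphi\,\mathrm dx\,\mathrm ds={}&\int_{\mathbb G}\big(\partial_tv(t,x)\varphi(t,x)-v(t,x)\partial_s\varphi(t,x)\big)\mathrm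 dx-\varepsilon\int_{\mathbb G}\big(v_1(x)\varphi(0,x)-v_0(x)\partial_s\varphi(0,x)\big)\mathrm dx\\&+\int_0^t\!\!\int_{\mathbb G}v\,\big(\partial_s^2\varphi-\mathcal L\varphi\big)\mathrm dx\,\mathrm ds.\end{aligned}$$ The *lifespan* of $(u,v)$ is $T(\varepsilon)=\sup\{\tau>0:(u,v)\text{ is an energy solution on }[0,\tau)\}\in(0,\infty]$; the solution *blows up in finite time* if $T(\varepsilon)<\infty$. **Theorem.** Let $u_0,v_0\in H^1_{\mathcal L}(\mathbb G)$ and $u_1,v_1\in L^2(\mathbb G)$ be non-negative (almost everywhere), and assume that each of the pairs $(u_0,u_1)$ and $(v_0,v_1)$ has at least one component which is not almost everywhere zero. Then there are constants $\varepsilon_0>0$ and $C>0$, depending only on $\mathbb G$, its metric, $u_0,u_1,v_0,v_1,b,m^2,p,q$ (in particular, not on $\varepsilon$ or on the solution), such that for every $\varepsilon\in(0,\varepsilon_0]$ every energy solution $(u,v)$ (on some $[0,T)$ with $T>0$) blows up in finite time, and its lifespan satisfies $$T(\varepsilon)\le\begin{cases}C\,\varepsilon^{-\frac{pq-1}{pq+1}}&\text{if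 }v_1\ne0,\\[2pt] C\,\varepsilon^{-\frac{pq-1}{2}}&\text{if }v_1=0.\end{cases}$$ -/

import Mathlib

open MeasureTheory Set
open scoped Manifold ContDiff ENNReal

noncomputable section

namespace CompactLieWave

variable {n : ℕ} {G : Type*} [TopologicalSpace G] [ChartedSpace (EuclideanSpace ℝ (Fin n)) G]

/-- Smooth Riemannian metrics on the `n`-dimensional smooth manifold `G`. -/
abbrev RiemMetric (n : ℕ) (G : Type*) [TopologicalSpace G]
    [ChartedSpace (EuclideanSpace ℝ (Fin n)) G] [IsManifold (𝓡 n) 1 G] : Type _ :=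
  Bundle.ContMDiffRiemannianMetric (𝓡 n) ∞ (EuclideanSpace ℝ (Fin n))
    (fun x : G => TangentSpace (𝓡 n) x)

/-- The partial derivative `∂_i h (y)` of a function on `ℝⁿ`. -/
def partialDeriv (i : Fin n) (h : EuclideanSpace ℝ (Fin n) → ℝ)
    (y : EuclideanSpace ℝ (Fin n)) : ℝ :=
  fderiv ℝ h y (EuclideanSpace.single i 1)

/-- The coordinate vector field `∂_i` of the chart around `x`, at the point of `G` with
coordinates `y`. -/
def coordVec (x : G) (y : EuclideanSpace ℝ (Fin n)) (i : Fin n) :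
    TangentSpace (𝓡 n) ((extChartAt (𝓡 n) x).symm y) :=
  mfderiv 𝓘(ℝ, EuclideanSpace ℝ (Fin n)) (𝓡 n) (extChartAt (𝓡 n) x).symm y
    (EuclideanSpace.single i 1 : EuclideanSpace ℝ (Fin n))

/-- The coefficient matrix `(g_ij)` of the metric in the chart around `x`, at the coordinates
`y`. -/
def coordMetric [IsManifold (𝓡 n) 1 G] (g : RiemMetric n G) (x : G)
    (y : EuclideanSpace ℝ (Fin n)) : Matrix (Fin n) (Fin n) ℝ :=
  Matrix.of fun i j =>
    g.inner ((extChartAt (𝓡 n) x).symm y) (coordVec x y i) (coordVec x y j)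

/-- The Laplace-Beltrami operator `(det g)^(-1/2) ∑_i ∂_i ((det g)^(1/2) ∑_j g^ij ∂_j f)`,
computed at `x` in the preferred chart around `x`. -/
def laplaceBeltrami [IsManifold (𝓡 n) 1 G] (g : RiemMetric n G) (f : G → ℝ) (x : G) : ℝ :=
  (√(coordMetric g x (extChartAt (𝓡 n) x x)).det)⁻¹ *
    ∑ i, partialDeriv i
      (fun y => √(coordMetric g x y).det *
        ∑ j, (coordMetric g x y)⁻¹ i j *
          partialDeriv j (fun z => f ((extChartAt (𝓡 n) x).symm z)) y)
      (extChartAt (𝓡 n) x x)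

/-- A Riemannian metric on a group is bi-invariant if all left and all right translations are
isometries. -/
def IsBiInvariant [Group G] [IsManifold (𝓡 n) 1 G] (g : RiemMetric n G) : Prop :=
  ∀ (a x : G) (w z : TangentSpace (𝓡 n) x),
    g.inner (a * x) (mfderiv (𝓡 n) (𝓡 n) (fun y : G => a * y) x w)
        (mfderiv (𝓡 n) (𝓡 n) (fun y : G => a * y) x z) = g.inner x w z ∧
    g.inner (x * a) (mfderiv (𝓡 n) (𝓡 n) (fun y : G => y * a) x w)
        (mfderiv (𝓡 n) (𝓡 n) (fun y : G => y * a) x z) = g.inner x w z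

variable [MeasurableSpace G]

/-- `h = (-𝓛)^(1/2) f` for `f, h ∈ L²(G)`, in the sense of the spectral decomposition of `-𝓛`:
the coefficient of `h` along every (smooth) eigenfunction `e` of `-𝓛`, with eigenvalue `l ≥ 0`,
is `√l` times the coefficient of `f`. As the eigenfunctions span a dense subspace of `L²(G)`,
`f` determines `h`. -/
def IsSqrtNegLaplacian [IsManifold (𝓡 n) 1 G] (g : RiemMetric n G) (μ : Measure G)
    (f h : Lp ℝ 2 μ) : Prop :=
  ∀ (l : ℝ) (e : G → ℝ), 0 ≤ l → ContMDiff (𝓡 n) 𝓘(ℝ, ℝ) ∞ e →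
    (∀ x, -laplaceBeltrami g e x = l * e x) →
    ∫ x, h x * e x ∂μ = √l * ∫ x, f x * e x ∂μ

/-- Membership in the Sobolev space `H¹(G) = {f ∈ L²(G) : (-𝓛)^(1/2) f ∈ L²(G)}`. -/
def MemH1 [IsManifold (𝓡 n) 1 G] (g : RiemMetric n G) (μ : Measure G) (f : Lp ℝ 2 μ) : Prop :=
  ∃ h : Lp ℝ 2 μ, IsSqrtNegLaplacian g μ f h

/-- `u ∈ C([0,T), H¹(G))` for the norm `‖f‖_{L²} + ‖(-𝓛)^(1/2) f‖_{L²}`. -/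
def ContinuousInH1 [IsManifold (𝓡 n) 1 G] (g : RiemMetric n G) (μ : Measure G)
    (T : ℝ) (u : ℝ → Lp ℝ 2 μ) : Prop :=
  ContinuousOn u (Ico 0 T) ∧
    ∃ w : ℝ → Lp ℝ 2 μ, ContinuousOn w (Ico 0 T) ∧
      ∀ t ∈ Ico 0 T, IsSqrtNegLaplacian g μ (u t) (w t)

/-- `u ∈ L^r_loc([0,T) × G)`, written as `u ∈ L^r((0,t); L^r(G))` for all `t < T` (every compact
subset of `[0,T) × G` lies in some `[0,t] × G`, as `G` is compact). -/
def MemLrLoc {G : Type*} [MeasurableSpace G] (μ : Measure G) (T r : ℝ)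
    (u : ℝ → Lp ℝ 2 μ) : Prop :=
  ∀ t ∈ Ioo 0 T,
    (∀ᵐ s ∂(volume.restrict (Ioc 0 t)), Integrable (fun x => |u s x| ^ r) μ) ∧
    IntegrableOn (fun s => ∫ x, |u s x| ^ r ∂μ) (Ioc 0 t)

/-- The test functions `C₀^∞([0,T) × G)`: restrictions to `[0,T) × G` of smooth functions on
`ℝ × G` which vanish for all times `s ≥ T'`, for some `T' < T` (for `G` compact this says that
the support in `[0,T) × G` is compact). -/
def IsTestFunction (n : ℕ) {G : Type*} [TopologicalSpace G]
    [ChartedSpace (EuclideanSpace ℝ (Fin n)) G] (T : ℝ) (ψ : ℝ → G → ℝ) : Prop :=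
  ContMDiff (𝓘(ℝ, ℝ).prod (𝓡 n)) 𝓘(ℝ, ℝ) ∞ (fun z : ℝ × G => ψ z.1 z.2) ∧
    ∃ T' < T, ∀ s, T' ≤ s → ∀ x, ψ s x = 0

/-- `∂_s ψ (s, x)`. -/
def dt {G : Type*} (ψ : ℝ → G → ℝ) (s : ℝ) (x : G) : ℝ := deriv (fun r => ψ r x) s

/-- The velocity `∂_t u (t) ∈ L²(G)` of a curve on `[0,T)` (one-sided at `t = 0`). -/
def vel {G : Type*} [MeasurableSpace G] {μ : Measure G} (T : ℝ) (u : ℝ → Lp ℝ 2 μ) (t : ℝ) :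
    Lp ℝ 2 μ :=
  derivWithin u (Ico 0 T) t

/-- `(u, v)` is an energy solution on `[0,T)` of the weakly coupled system
`u_tt - 𝓛u + b u_t + m² u = |v|^p`, `v_tt - 𝓛v = |u|^q` with data
`(u, u_t)(0) = ε (u₀, u₁)`, `(v, v_t)(0) = ε (v₀, v₁)`. -/
structure IsEnergySolution [IsManifold (𝓡 n) 1 G] (g : RiemMetric n G) (μ : Measure G)
    (b m p q ε : ℝ) (u₀ u₁ v₀ v₁ : Lp ℝ 2 μ) (T : ℝ) (u v : ℝ → Lp ℝ 2 μ) : Prop where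
  u_H1 : ContinuousInH1 g μ T u
  u_C1 : ContDiffOn ℝ 1 u (Ico 0 T)
  u_Lq : MemLrLoc μ T q u
  v_H1 : ContinuousInH1 g μ T v
  v_C1 : ContDiffOn ℝ 1 v (Ico 0 T)
  v_Lp : MemLrLoc μ T p v
  eq_u : ∀ ψ : ℝ → G → ℝ, IsTestFunction n T ψ → ∀ t ∈ Ioo 0 T,
    ∫ s in (0 : ℝ)..t, ∫ x, |v s x| ^ p * ψ s x ∂μ =
      ∫ x, vel T u t x * ψ t x ∂μ - ∫ x, u t x * dt ψ t x ∂μ + b * ∫ x, u t x * ψ t x ∂μ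
      - ε * ∫ x, u₁ x * ψ 0 x ∂μ + ε * ∫ x, u₀ x * dt ψ 0 x ∂μ
      - ε * b * ∫ x, u₀ x * ψ 0 x ∂μ
      + ∫ s in (0 : ℝ)..t, ∫ x, u s x *
          (dt (dt ψ) s x - laplaceBeltrami g (ψ s) x - b * dt ψ s x + m ^ 2 * ψ s x) ∂μ
  eq_v : ∀ φ : ℝ → G → ℝ, IsTestFunction n T φ → ∀ t ∈ Ioo 0 T,
    ∫ s in (0 : ℝ)..t, ∫ x, |u s x| ^ q * φ s x ∂μ =
      ∫ x, vel T v t x * φ t x ∂μ - ∫ x, v t x * dt φ t x ∂μ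
      - ε * ∫ x, v₁ x * φ 0 x ∂μ + ε * ∫ x, v₀ x * dt φ 0 x ∂μ
      + ∫ s in (0 : ℝ)..t, ∫ x, v s x *
          (dt (dt φ) s x - laplaceBeltrami g (φ s) x) ∂μ

/-- The lifespan of `(u, v)`: the supremum in `[0,∞]` of all `τ > 0` such that `(u, v)` is an
energy solution on `[0,τ)`. -/
def lifespan [IsManifold (𝓡 n) 1 G] (g : RiemMetric n G) (μ : Measure G)
    (b m p q ε : ℝ) (u₀ u₁ v₀ v₁ : Lp ℝ 2 μ) (u v : ℝ → Lp ℝ 2 μ) : ℝ≥0∞ :=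
  ⨆ (τ : ℝ) (_ : 0 < τ ∧ IsEnergySolution g μ b m p q ε u₀ u₁ v₀ v₁ τ u v), ENNReal.ofReal τ

end CompactLieWave

end

open MeasureTheory Set
open scoped Manifold ContDiff ENNReal

namespace CompactLieWave

/-! ### Blow-up for a delayed integral inequality -/

/-! Averaging over the group reduces the system to ordinary differential inequalities. Constants are
killed by the Laplacian, so testing with functions of time alone gives, for the means `U`, `V` of
`u`, `v`, the equations `U'' + bU' + m²U = P` and `V'' = F` in integrated form, where `P`, `F` are
the means of `|v|^p`, `|u|^q`; Jensen gives `P ≥ |V|^p` and `F ≥ |U|^q`. Since `b² ≥ 4m²`, the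
damped oscillator has a non-negative fundamental solution `K`, so non-negative data only help and `U
≥ K * P`, while `V` is nondecreasing.

Blow-up comes from a doubling argument (`doubling`). If `V ≥ A` from some time on, then after a
delay `δ ≤ 1` one has `U ≥ c A^p δ²`, and after a further time `σ` the value of `V` has grown by at
least `c' A^(pq) δ^(2q) σ²` (`V_step`). As `pq > 1`, geometrically decreasing `δ` and `σ` suffice to
double `V` at every step, so `V` would be unbounded within time `C₁ + C₂ A^(-(pq-1)/2)`. The
lifespan bounds follow from `V(t) ≥ ε(V₀ + V₁ t)`, where `V₀`, `V₁` are the means of `v₀`, `v₁`, by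
choosing the starting time. -/

theorem mul_sq_half_le_integral {a a₀ t e M : ℝ} {k F : ℝ → ℝ} (ha₀ : a₀ ≤ a) (hat : a ≤ t)
    (hM : 0 ≤ M) (hk : Continuous k) (hk0 : ∀ s ∈ Icc a₀ t, 0 ≤ k s)
    (hke : ∀ s ∈ Icc a t, e * (t - s) ≤ k s)
    (hF0 : ∀ s, 0 ≤ F s) (hF : IntervalIntegrable F volume a₀ t)
    (hFM : ∀ᵐ s ∂volume.restrict (Ioc a t), M ≤ F s) :
    e * M * ((t - a) ^ 2 / 2) ≤ ∫ s in a₀..t, k s * F s := by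
  have hkF : IntervalIntegrable (fun s => k s * F s) volume a₀ t := hF.continuousOn_mul hk.continuousOn
  have hsub : uIcc a t ⊆ uIcc a₀ t := by
    rw [uIcc_of_le hat, uIcc_of_le (ha₀.trans hat)]; exact Icc_subset_Icc_left ha₀
  have hsub' : uIcc a₀ a ⊆ uIcc a₀ t := by
    rw [uIcc_of_le ha₀, uIcc_of_le (ha₀.trans hat)]; exact Icc_subset_Icc_right hat
  have h1 := intervalIntegral.integral_add_adjacent_intervals (hkF.mono_set hsub')
    (hkF.mono_set hsub)
  have h2 : 0 ≤ ∫ s in a₀..a, k s * F s :=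
    intervalIntegral.integral_nonneg ha₀ fun s hs =>
      mul_nonneg (hk0 s ⟨hs.1, hs.2.trans hat⟩) (hF0 s)
  have h3 : ∫ s in a..t, e * M * (t - s) ≤ ∫ s in a..t, k s * F s := by
    apply intervalIntegral.integral_mono_ae_restrict hat
    · exact (by fun_prop : Continuous fun s : ℝ => e * M * (t - s)).intervalIntegrable _ _
    · exact hkF.mono_set hsub
    · rw [← restrict_Ioc_eq_restrict_Icc]
      filter_upwards [hFM, ae_restrict_mem measurableSet_Ioc] with s hs hsI
      have h4 := hke s ⟨hsI.1.le, hsI.2⟩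
      have h5 := hk0 s ⟨ha₀.trans hsI.1.le, hsI.2⟩
      calc e * M * (t - s) = e * (t - s) * M := by ring
        _ ≤ k s * M := by gcongr
        _ ≤ k s * F s := by gcongr
  have h4 : ∫ s in a..t, e * M * (t - s) = e * M * ((t - a) ^ 2 / 2) := by
    rw [intervalIntegral.integral_const_mul,
      intervalIntegral.integral_comp_sub_left (fun s => s) t, integral_id]
    ring
  linarith

/-- Averaged form of the system: `V` solves `V'' = F`, `U` dominates the convolution of `P` with
the kernel `K`, and `F ≥ |U|^q`, `P ≥ |V|^p`. -/
structure AveragedSystem (p q e c₀ c₁ T : ℝ) (K F P U V : ℝ → ℝ) : Prop where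
  c₁_nonneg : 0 ≤ c₁
  F_nonneg : ∀ s, 0 ≤ F s
  P_nonneg : ∀ s, 0 ≤ P s
  F_integrable : ∀ t ∈ Ioo 0 T, IntervalIntegrable F volume 0 t
  P_integrable : ∀ t ∈ Ioo 0 T, IntervalIntegrable P volume 0 t
  K_cont : Continuous K
  K_nonneg : ∀ s, 0 ≤ s → 0 ≤ K s
  le_K : ∀ s, 0 ≤ s → s ≤ 1 → e * s ≤ K s
  V_eq : ∀ t ∈ Ioo 0 T, V t = c₀ + c₁ * t + ∫ s in (0 : ℝ)..t, (t - s) * F s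
  le_U : ∀ t ∈ Ioo 0 T, ∫ s in (0 : ℝ)..t, K (t - s) * P s ≤ U t
  le_F : ∀ t ∈ Ioo 0 T, ∀ᵐ s ∂volume.restrict (Ioc 0 t), |U s| ^ q ≤ F s
  le_P : ∀ t ∈ Ioo 0 T, ∀ᵐ s ∂volume.restrict (Ioc 0 t), |V s| ^ p ≤ P s

namespace AveragedSystem

variable {p q e c₀ c₁ T : ℝ} {K F P U V : ℝ → ℝ}

theorem add_integral_le (h : AveragedSystem p q e c₀ c₁ T K F P U V) {t₀ t : ℝ} (h0 : 0 < t₀)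
    (ht₀ : t₀ ≤ t) (ht : t < T) :
    V t₀ + ∫ s in t₀..t, (t - s) * F s ≤ V t := by
  have hF := h.F_integrable t ⟨by linarith, ht⟩
  have hF₀ := h.F_integrable t₀ ⟨h0, by linarith⟩
  have hF₁ : IntervalIntegrable F volume t₀ t := hF₀.symm.trans hF
  rw [h.V_eq t ⟨by linarith, ht⟩, h.V_eq t₀ ⟨h0, by linarith⟩,
    ← intervalIntegral.integral_add_adjacent_intervals
      (hF₀.continuousOn_mul (by fun_prop : Continuous fun s : ℝ => t - s).continuousOn)
      (hF₁.continuousOn_mul (by fun_prop : Continuous fun s : ℝ => t - s).continuousOn)]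
  have h1 : ∫ s in (0 : ℝ)..t₀, (t₀ - s) * F s ≤ ∫ s in (0 : ℝ)..t₀, (t - s) * F s := by
    apply intervalIntegral.integral_mono_on h0.le
    · exact hF₀.continuousOn_mul (by fun_prop : Continuous fun s : ℝ => t₀ - s).continuousOn
    · exact hF₀.continuousOn_mul (by fun_prop : Continuous fun s : ℝ => t - s).continuousOn
    · intro s _
      have := h.F_nonneg s
      gcongr
  have h2 := mul_le_mul_of_nonneg_left ht₀ h.c₁_nonneg
  linarith

theorem mono (h : AveragedSystem p q e c₀ c₁ T K F P U V) {t₀ t : ℝ} (h0 : 0 < t₀)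
    (ht₀ : t₀ ≤ t) (ht : t < T) : V t₀ ≤ V t := by
  have h1 := h.add_integral_le h0 ht₀ ht
  have h2 : 0 ≤ ∫ s in t₀..t, (t - s) * F s :=
    intervalIntegral.integral_nonneg ht₀ fun s hs =>
      mul_nonneg (by linarith [hs.2]) (h.F_nonneg s)
  linarith

theorem le_V (h : AveragedSystem p q e c₀ c₁ T K F P U V) {t : ℝ} (h0 : 0 < t) (ht : t < T) :
    c₀ + c₁ * t ≤ V t := by
  rw [h.V_eq t ⟨h0, ht⟩]
  have h2 : 0 ≤ ∫ s in (0 : ℝ)..t, (t - s) * F s :=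
    intervalIntegral.integral_nonneg h0.le fun s hs =>
      mul_nonneg (by linarith [hs.2]) (h.F_nonneg s)
  linarith

/-- Only the last `δ` units of time before `s` are kept in the convolution: there `V ≥ A` by
monotonicity, and `δ ≤ 1` keeps the argument of `K` in the range where `K` has a linear lower bound.
-/
theorem U_lower (h : AveragedSystem p q e c₀ c₁ T K F P U V) (hp : 0 < p) {t₀ δ s A : ℝ}
    (h0 : 0 < t₀) (hA : 0 ≤ A) (hVA : A ≤ V t₀) (hδ : 0 < δ) (hδ1 : δ ≤ 1)
    (hs : t₀ + δ ≤ s) (hsT : s < T) : e * A ^ p * (δ ^ 2 / 2) ≤ U s := by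
  have hs0 : s ∈ Ioo 0 T := ⟨by linarith, hsT⟩
  refine le_trans ?_ (h.le_U s hs0)
  have h1 := mul_sq_half_le_integral (a := s - δ) (a₀ := 0) (t := s) (e := e) (M := A ^ p)
    (k := fun r => K (s - r)) (F := P) (by linarith) (by linarith) (by positivity)
    (h.K_cont.comp (by fun_prop)) (fun r hr => h.K_nonneg _ (by linarith [hr.2]))
    (fun r hr => h.le_K _ (by linarith [hr.2]) (by linarith [hr.1])) h.P_nonneg
    (h.P_integrable s hs0) ?_
  · simpa using h1
  · have h2 := ae_restrict_of_ae_restrict_of_subset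
      (Ioc_subset_Ioc_left (by linarith : 0 ≤ s - δ)) (h.le_P s hs0)
    filter_upwards [h2, ae_restrict_mem measurableSet_Ioc] with r hr hrI
    refine le_trans ?_ hr
    have h3 : A ≤ V r :=
      hVA.trans (h.mono h0 (by linarith [hrI.1]) (by linarith [hrI.2]))
    exact Real.rpow_le_rpow hA (h3.trans (le_abs_self _)) hp.le

/-- One turn around the coupling: the bound on `V` yields one on `U` after the delay `δ`, which is
fed into `V'' = F` over the remaining time `σ`. -/
theorem V_step (h : AveragedSystem p q e c₀ c₁ T K F P U V) (hp : 0 < p) (hq : 0 < q)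
    (he : 0 ≤ e) {t₀ δ σ A : ℝ} (h0 : 0 < t₀) (hA : 0 ≤ A) (hVA : A ≤ V t₀) (hδ : 0 < δ)
    (hδ1 : δ ≤ 1) (hσ : 0 ≤ σ) (hT : t₀ + δ + σ < T) :
    A + (e / 2) ^ q * A ^ (p * q) * δ ^ (2 * q) * (σ ^ 2 / 2) ≤ V (t₀ + δ + σ) := by
  set t := t₀ + δ + σ with ht
  have ht0 : t ∈ Ioo 0 T := ⟨by positivity, hT⟩
  have h1 := h.add_integral_le h0 (by linarith : t₀ ≤ t) hT
  have h2 := mul_sq_half_le_integral (a := t₀ + δ) (a₀ := t₀) (t := t) (e := 1)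
    (M := (e * A ^ p * (δ ^ 2 / 2)) ^ q)
    (k := fun r => t - r) (F := F) (by linarith) (by linarith) (by positivity)
    (by fun_prop) (fun r hr => by linarith [hr.2])
    (fun r hr => by linarith) h.F_nonneg
    ((h.F_integrable t₀ ⟨h0, by linarith⟩).symm.trans (h.F_integrable t ht0)) ?_
  · have h3 : (e * A ^ p * (δ ^ 2 / 2)) ^ q = (e / 2) ^ q * A ^ (p * q) * δ ^ (2 * q) := by
      rw [show e * A ^ p * (δ ^ 2 / 2) = e / 2 * A ^ p * δ ^ 2 by ring,
        Real.mul_rpow (by positivity) (by positivity),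
        Real.mul_rpow (by positivity) (by positivity), ← Real.rpow_mul hA,
        ← Real.rpow_natCast δ 2, ← Real.rpow_mul hδ.le]
      norm_num
    rw [h3, show t - (t₀ + δ) = σ by rw [ht]; ring] at h2
    linarith
  · have h2 := ae_restrict_of_ae_restrict_of_subset
      (Ioc_subset_Ioc_left (by linarith : 0 ≤ t₀ + δ)) (h.le_F t ht0)
    filter_upwards [h2, ae_restrict_mem measurableSet_Ioc] with r hr hrI
    refine le_trans ?_ hr
    exact Real.rpow_le_rpow (by positivity)
      ((h.U_lower hp h0 hA hVA hδ hδ1 hrI.1.le (by linarith [hrI.2])).trans (le_abs_self _)) hq.le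

/-- The amplitude `V` doubles along the times `t₀ + ∑_{j<k} (x^j + S y^j)`. -/
theorem doubling (h : AveragedSystem p q e c₀ c₁ T K F P U V) (hp : 0 < p) (hq : 0 < q)
    (he : 0 < e) {t₀ A x y S : ℝ} (h0 : 0 < t₀) (hA : 0 < A) (hVA : A ≤ V t₀)
    (hx : 0 < x) (hx1 : x < 1) (hy : 0 < y) (hy1 : y < 1)
    (hxy : x ^ (2 * q) * y ^ 2 * 2 ^ (p * q - 1) = 1) (hS : 0 ≤ S)
    (hSA : (e / 2) ^ q * A ^ (p * q - 1) * S ^ 2 = 2)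
    (hT : t₀ + (1 - x)⁻¹ + S * (1 - y)⁻¹ < T) (k : ℕ) :
    2 ^ k * A ≤ V (t₀ + (1 - x ^ k) * (1 - x)⁻¹ + S * ((1 - y ^ k) * (1 - y)⁻¹)) := by
  have hx' : 0 < 1 - x := by linarith
  have hy' : 0 < 1 - y := by linarith
  have hle : ∀ j : ℕ, t₀ + (1 - x ^ j) * (1 - x)⁻¹ + S * ((1 - y ^ j) * (1 - y)⁻¹) < T := by
    intro j
    refine lt_of_le_of_lt ?_ hT
    have h1 : (1 - x ^ j) * (1 - x)⁻¹ ≤ 1 * (1 - x)⁻¹ := by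
      gcongr
      linarith [pow_pos hx j]
    have h2 : (1 - y ^ j) * (1 - y)⁻¹ ≤ 1 * (1 - y)⁻¹ := by
      gcongr
      linarith [pow_pos hy j]
    have h3 := mul_le_mul_of_nonneg_left h2 hS
    linarith
  induction k with
  | zero => simpa using hVA
  | succ k ih =>
    set t := t₀ + (1 - x ^ k) * (1 - x)⁻¹ + S * ((1 - y ^ k) * (1 - y)⁻¹) with ht
    have hnext : t₀ + (1 - x ^ (k + 1)) * (1 - x)⁻¹ + S * ((1 - y ^ (k + 1)) * (1 - y)⁻¹)
        = t + x ^ k + S * y ^ k := by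
      rw [ht]
      field_simp
      ring
    have ht0 : 0 < t := by
      have h1 : 0 ≤ 1 - x ^ k := by linarith [pow_le_one₀ hx.le hx1.le (n := k)]
      have h2 : 0 ≤ 1 - y ^ k := by linarith [pow_le_one₀ hy.le hy1.le (n := k)]
      positivity
    have hst := h.V_step hp hq he.le (δ := x ^ k) (σ := S * y ^ k) ht0
      (by positivity : 0 ≤ 2 ^ k * A) ih (by positivity)
      (pow_le_one₀ hx.le hx1.le) (by positivity) (by rw [← hnext]; exact hle (k + 1))
    rw [hnext]
    refine le_trans (le_of_eq ?_) hst
    have e1 : (2 ^ k * A) ^ (p * q) = (2 ^ (p * q - 1)) ^ k * A ^ (p * q - 1) * (2 ^ k * A) := by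
      have hB : 0 < 2 ^ k * A := by positivity
      have e0 : ((2 : ℝ) ^ (p * q - 1)) ^ k = (2 ^ k) ^ (p * q - 1) := by
        rw [← Real.rpow_natCast, ← Real.rpow_natCast, ← Real.rpow_mul (by norm_num),
          ← Real.rpow_mul (by norm_num), mul_comm]
      rw [e0, ← Real.mul_rpow (by positivity) hA.le, ← Real.rpow_add_one hB.ne', sub_add_cancel]
    have e2 : (x ^ k) ^ (2 * q) = (x ^ (2 * q)) ^ k := by
      rw [← Real.rpow_natCast, ← Real.rpow_natCast, ← Real.rpow_mul hx.le, ← Real.rpow_mul hx.le,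
        mul_comm]
    have e3 : (x ^ (2 * q)) ^ k * (y ^ k) ^ 2 * ((2 : ℝ) ^ (p * q - 1)) ^ k = 1 := by
      rw [← pow_mul, mul_comm k 2, pow_mul, ← mul_pow, ← mul_pow, hxy, one_pow]
    rw [e1, e2]
    -- The increment must equal the current value `2 ^ k * A`. The normalization `hxy` makes the
    -- shrinking of the time steps cancel the growth of `A ^ (p * q - 1)`, and `hSA` settles the
    -- first step.
    calc 2 ^ (k + 1) * A
        = 2 ^ k * A + 1 * (2 / 2) * (2 ^ k * A) := by ring
      _ = 2 ^ k * A + ((x ^ (2 * q)) ^ k * (y ^ k) ^ 2 * ((2 : ℝ) ^ (p * q - 1)) ^ k) *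
            ((e / 2) ^ q * A ^ (p * q - 1) * S ^ 2 / 2) * (2 ^ k * A) := by rw [e3, hSA]
      _ = _ := by ring

end AveragedSystem

/-- The two constants come from summing the geometric series of the delays `x ^ k` and of the growth
times `S * y ^ k`. The lower bound at `t₀` is needed only for `t₀ < T`, as otherwise the conclusion
is trivial. -/
theorem exists_averagedSystem_bound {p q e : ℝ} (hp : 1 < p) (hq : 1 < q) (he : 0 < e) :
    ∃ C₁ C₂ : ℝ, 0 < C₁ ∧ 0 < C₂ ∧ ∀ (c₀ c₁ T : ℝ) (K F P U V : ℝ → ℝ),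
      AveragedSystem p q e c₀ c₁ T K F P U V → ∀ t₀ A : ℝ, 0 < t₀ → 0 < A →
      (t₀ < T → A ≤ V t₀) → T ≤ t₀ + C₁ + C₂ * A ^ (-((p * q - 1) / 2)) := by
  have hκ : 0 < p * q - 1 := by nlinarith
  have hp0 : 0 < p := by linarith
  have hq0 : 0 < q := by linarith
  -- The exponents make `x ^ (2 * q)` and `y ^ 2` each equal to `2 ^ (-((p * q - 1) / 2))`, sharing
  -- the required decay equally.
  obtain ⟨x, hxdef⟩ : ∃ x : ℝ, x = 2 ^ (-((p * q - 1) / (4 * q))) := ⟨_, rfl⟩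
  obtain ⟨y, hydef⟩ : ∃ y : ℝ, y = 2 ^ (-((p * q - 1) / 4)) := ⟨_, rfl⟩
  have hx : 0 < x := by rw [hxdef]; positivity
  have hy : 0 < y := by rw [hydef]; positivity
  have hx1 : x < 1 := by
    rw [hxdef]
    exact Real.rpow_lt_one_of_one_lt_of_neg (by norm_num) (by simp only [neg_neg_iff_pos]; positivity)
  have hy1 : y < 1 := by
    rw [hydef]
    exact Real.rpow_lt_one_of_one_lt_of_neg (by norm_num) (by simp only [neg_neg_iff_pos]; positivity)
  have hx' : 0 < 1 - x := by linarith
  have hy' : 0 < 1 - y := by linarith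
  have hxy : x ^ (2 * q) * y ^ 2 * 2 ^ (p * q - 1) = 1 := by
    rw [hxdef, hydef, ← Real.rpow_natCast _ 2, ← Real.rpow_mul (by norm_num),
      ← Real.rpow_mul (by norm_num), ← Real.rpow_add (by norm_num), ← Real.rpow_add (by norm_num)]
    convert Real.rpow_zero (2 : ℝ) using 2
    push_cast
    field_simp
    ring
  have hc : 0 < (e / 2) ^ q := by positivity
  refine ⟨(1 - x)⁻¹, √(2 / (e / 2) ^ q) * (1 - y)⁻¹, by positivity, by positivity, ?_⟩
  intro c₀ c₁ T K F P U V h t₀ A h0 hA hVA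
  by_contra! hT
  set S := √(2 / (e / 2) ^ q) * A ^ (-((p * q - 1) / 2)) with hS
  have hS0 : 0 ≤ S := by positivity
  have hT' : t₀ + (1 - x)⁻¹ + S * (1 - y)⁻¹ < T := by
    refine lt_of_eq_of_lt ?_ hT
    rw [hS]; ring
  have hSA : (e / 2) ^ q * A ^ (p * q - 1) * S ^ 2 = 2 := by
    rw [hS, mul_pow, Real.sq_sqrt (by positivity), ← Real.rpow_natCast _ 2, ← Real.rpow_mul hA.le]
    have : A ^ (p * q - 1) * A ^ (-((p * q - 1) / 2) * ((2 : ℕ) : ℝ)) = 1 := by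
      rw [← Real.rpow_add hA]
      convert Real.rpow_zero A using 2
      push_cast
      ring
    calc _ = (e / 2) ^ q * (2 / (e / 2) ^ q) *
          (A ^ (p * q - 1) * A ^ (-((p * q - 1) / 2) * ((2 : ℕ) : ℝ))) := by ring
      _ = 2 := by rw [this]; field_simp
  have ht₀T : t₀ < T := by
    have : 0 < (1 - x)⁻¹ := by positivity
    have : 0 ≤ S * (1 - y)⁻¹ := by positivity
    linarith
  have hd := h.doubling hp0 hq0 he h0 hA (hVA ht₀T) hx hx1 hy hy1 hxy hS0 hSA hT'
  -- All doubling times precede the limit time, which is still below `T`; monotonicity makes the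
  -- finite value of `V` there dominate every `2 ^ k * A`, a contradiction.
  obtain ⟨k, hk⟩ := pow_unbounded_of_one_lt
    (V (t₀ + (1 - x)⁻¹ + S * (1 - y)⁻¹) / A) (by norm_num : (1 : ℝ) < 2)
  rw [div_lt_iff₀ hA] at hk
  have h1 : 0 ≤ 1 - x ^ k := by linarith [pow_le_one₀ hx.le hx1.le (n := k)]
  have h2 : 0 ≤ 1 - y ^ k := by linarith [pow_le_one₀ hy.le hy1.le (n := k)]
  have hmono := h.mono (t₀ := t₀ + (1 - x ^ k) * (1 - x)⁻¹ + S * ((1 - y ^ k) * (1 - y)⁻¹))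
    (by positivity) ?_ hT'
  · linarith [hd k]
  · have h3 : (1 - x ^ k) * (1 - x)⁻¹ ≤ 1 * (1 - x)⁻¹ := by
      gcongr
      linarith [pow_pos hx k]
    have h4 : (1 - y ^ k) * (1 - y)⁻¹ ≤ 1 * (1 - y)⁻¹ := by
      gcongr
      linarith [pow_pos hy k]
    have h5 := mul_le_mul_of_nonneg_left h4 hS0
    linarith
/-! ### The fundamental solution of the damped oscillator -/

/-- `S` is `sinh (d τ) / d`, replaced by its limit `τ` when `d = 0`, so that critical damping `b² =
4m²` needs no separate treatment later. -/
theorem exists_sinh_kernel {d : ℝ} (hd : 0 ≤ d) :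
    ∃ S : ℝ → ℝ, ContDiff ℝ ∞ S ∧ S 0 = 0 ∧ (∀ τ, HasDerivAt S (Real.cosh (d * τ)) τ) ∧
      (∀ τ, Real.sinh (d * τ) * d = d ^ 2 * S τ) ∧ ∀ τ, 0 ≤ τ → τ ≤ S τ := by
  rcases hd.eq_or_lt with rfl | hd
  · exact ⟨id, contDiff_id, rfl, fun τ => by simpa using hasDerivAt_id τ, by simp,
      fun τ _ => le_rfl⟩
  · refine ⟨fun τ => Real.sinh (d * τ) / d, ?_, by simp, fun τ => ?_, fun τ => ?_, fun τ hτ => ?_⟩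
    · exact (Real.contDiff_sinh.comp (contDiff_const.mul contDiff_id)).div_const d
    · have h1 : HasDerivAt (fun τ => Real.sinh (d * τ)) (Real.cosh (d * τ) * d) τ := by
        simpa using ((hasDerivAt_id τ).const_mul d).sinh
      exact (h1.div_const d).congr_deriv (by field_simp)
    · field_simp
    · change τ ≤ Real.sinh (d * τ) / d
      rw [le_div_iff₀ hd, mul_comm]
      exact Real.self_le_sinh_iff.2 (by positivity)

/-- The kernel is `exp (-bτ/2) S(τ)` with `d² = b²/4 - m²`. The sign of `K' + bK` is recorded
because this is the factor multiplying `u₀` in the representation of the mean of `u`. -/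
theorem exists_damped_kernel {b m : ℝ} (hb : 0 < b) (hbm : 4 * m ^ 2 ≤ b ^ 2) :
    ∃ K K' : ℝ → ℝ, ContDiff ℝ ∞ K ∧ K 0 = 0 ∧ K' 0 = 1 ∧ (∀ τ, HasDerivAt K (K' τ) τ) ∧
      (∀ τ, HasDerivAt K' (-b * K' τ - m ^ 2 * K τ) τ) ∧ (∀ τ, 0 ≤ τ → 0 ≤ K τ) ∧
      (∀ τ, 0 ≤ τ → 0 ≤ K' τ + b * K τ) ∧
      ∀ τ, 0 ≤ τ → τ ≤ 1 → Real.exp (-(b / 2)) * τ ≤ K τ := by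
  obtain ⟨S, hS, hS0, hS', hSd, hSle⟩ := exists_sinh_kernel (Real.sqrt_nonneg (b ^ 2 / 4 - m ^ 2))
  have hd2 := Real.sq_sqrt (by linarith : 0 ≤ b ^ 2 / 4 - m ^ 2)
  set d := √(b ^ 2 / 4 - m ^ 2)
  have hE : ∀ τ, HasDerivAt (fun τ => Real.exp (-(b / 2) * τ))
      (Real.exp (-(b / 2) * τ) * (-(b / 2))) τ := fun τ => by
    simpa using ((hasDerivAt_id τ).const_mul (-(b / 2))).exp
  refine ⟨fun τ => Real.exp (-(b / 2) * τ) * S τ,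
    fun τ => Real.exp (-(b / 2) * τ) * (Real.cosh (d * τ) - b / 2 * S τ), ?_, by simp [hS0],
    by simp [hS0], fun τ => ?_, fun τ => ?_, fun τ hτ => ?_, fun τ hτ => ?_, fun τ hτ hτ1 => ?_⟩
  · exact (Real.contDiff_exp.comp (contDiff_const.mul contDiff_id)).mul hS
  · refine ((hE τ).mul (hS' τ)).congr_deriv ?_
    ring
  · have hc : HasDerivAt (fun τ => Real.cosh (d * τ)) (Real.sinh (d * τ) * d) τ := by
      simpa using ((hasDerivAt_id τ).const_mul d).cosh
    have hcS : HasDerivAt (fun τ => Real.cosh (d * τ) - b / 2 * S τ)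
        (Real.sinh (d * τ) * d - b / 2 * Real.cosh (d * τ)) τ := hc.sub ((hS' τ).const_mul (b / 2))
    refine ((hE τ).mul hcS).congr_deriv ?_
    rw [hSd, hd2]
    ring
  · have := hτ.trans (hSle τ hτ)
    positivity
  · have h1 := hτ.trans (hSle τ hτ)
    have h2 := Real.cosh_pos (d * τ)
    have h3 : Real.exp (-(b / 2) * τ) * (Real.cosh (d * τ) - b / 2 * S τ) +
        b * (Real.exp (-(b / 2) * τ) * S τ) =
        Real.exp (-(b / 2) * τ) * (Real.cosh (d * τ) + b / 2 * S τ) := by ring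
    rw [h3]
    positivity
  · have h1 := hSle τ hτ
    change _ ≤ Real.exp (-(b / 2) * τ) * S τ
    gcongr
    nlinarith

/-! ### Testing with functions of time -/

/-- A cutoff equal to `1` slightly beyond `t` makes any smooth function of time admissible.
Agreement near each `s ≤ t`, not just at `s`, transfers the derivatives too, including at the
endpoint. -/
theorem exists_timeTest {n : ℕ} {G : Type*} [TopologicalSpace G]
    [ChartedSpace (EuclideanSpace ℝ (Fin n)) G] {T t : ℝ} (ht : t < T) {a : ℝ → ℝ}
    (ha : ContDiff ℝ ∞ a) :
    ∃ h : ℝ → ℝ, IsTestFunction n T (fun s (_ : G) => h s) ∧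
      ∀ s ≤ t, h =ᶠ[nhds s] a := by
  obtain ⟨t₁, ht₁, h1T⟩ := exists_between ht
  obtain ⟨t₂, ht₂, h2T⟩ := exists_between h1T
  refine ⟨fun s => a s * Real.smoothTransition ((t₂ - s) / (t₂ - t₁)), ⟨?_, t₂, h2T, ?_⟩, ?_⟩
  · have h1 : ContDiff ℝ ∞ fun s => a s * Real.smoothTransition ((t₂ - s) / (t₂ - t₁)) :=
      ha.mul (Real.smoothTransition.contDiff.comp
        ((contDiff_const.sub contDiff_id).div_const _))
    exact h1.contMDiff.comp contMDiff_fst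
  · intro s hs _
    have : (t₂ - s) / (t₂ - t₁) ≤ 0 :=
      div_nonpos_of_nonpos_of_nonneg (by linarith) (by linarith)
    simp [Real.smoothTransition.zero_of_nonpos this]
  · intro s hs
    filter_upwards [Iio_mem_nhds (lt_of_le_of_lt hs ht₁)] with r hr
    have hr' : r < t₁ := hr
    have : 1 ≤ (t₂ - r) / (t₂ - t₁) := by
      rw [le_div_iff₀ (by linarith)]
      linarith
    simp [Real.smoothTransition.one_of_one_le this]

variable {n : ℕ} {G : Type*} [TopologicalSpace G] [ChartedSpace (EuclideanSpace ℝ (Fin n)) G]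

theorem laplaceBeltrami_const [IsManifold (𝓡 n) 1 G] (g : RiemMetric n G) (c : ℝ) (x : G) :
    laplaceBeltrami g (fun _ => c) x = 0 := by
  simp [laplaceBeltrami, partialDeriv]

variable [MeasurableSpace G]

namespace IsEnergySolution

variable [IsManifold (𝓡 n) 1 G] {g : RiemMetric n G} {μ : Measure G}
  {b m p q ε : ℝ} {u₀ u₁ v₀ v₁ : Lp ℝ 2 μ} {T : ℝ} {u v : ℝ → Lp ℝ 2 μ}

/-- The condition `a t = 0` removes the velocity and damping terms at time `t`, leaving only the
mean of `u` there. -/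
theorem mean_u (h : IsEnergySolution g μ b m p q ε u₀ u₁ v₀ v₁ T u v) {t : ℝ} (ht : t ∈ Ioo 0 T)
    {a a' a'' : ℝ → ℝ} (ha : ContDiff ℝ ∞ a) (ha' : ∀ s, HasDerivAt a (a' s) s)
    (ha'' : ∀ s, HasDerivAt a' (a'' s) s) (hat : a t = 0) :
    ∫ s in (0 : ℝ)..t, a s * ∫ x, |v s x| ^ p ∂μ =
      -(a' t * ∫ x, u t x ∂μ) - ε * (a 0 * ∫ x, u₁ x ∂μ) + ε * (a' 0 * ∫ x, u₀ x ∂μ)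
      - ε * b * (a 0 * ∫ x, u₀ x ∂μ)
      + ∫ s in (0 : ℝ)..t, (a'' s - b * a' s + m ^ 2 * a s) * ∫ x, u s x ∂μ := by
  obtain ⟨k, hk, hka⟩ := exists_timeTest (n := n) (G := G) ht.2 ha
  have e0 : ∀ s ≤ t, k s = a s := fun s hs => (hka s hs).self_of_nhds
  have e1 : ∀ s ≤ t, deriv k s = a' s := fun s hs => by
    rw [(hka s hs).deriv_eq, (ha' s).deriv]
  have e2 : ∀ s ≤ t, deriv (deriv k) s = a'' s := fun s hs => by
    rw [(hka s hs).deriv.deriv_eq, show deriv a = a' from funext fun s => (ha' s).deriv,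
      (ha'' s).deriv]
  have key := h.eq_u _ hk t ht
  have d1 : ∀ s x, dt (fun s (_ : G) => k s) s x = deriv k s := fun _ _ => rfl
  have d2 : ∀ s x, dt (dt (fun s (_ : G) => k s)) s x = deriv (deriv k) s := fun _ _ => rfl
  simp only [d1, d2, laplaceBeltrami_const, integral_mul_const] at key
  rw [e0 t le_rfl, e1 t le_rfl, e0 0 ht.1.le, e1 0 ht.1.le, hat] at key
  have i1 : ∫ s in (0 : ℝ)..t, (∫ x, |v s x| ^ p ∂μ) * k s =
      ∫ s in (0 : ℝ)..t, a s * ∫ x, |v s x| ^ p ∂μ := by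
    apply intervalIntegral.integral_congr
    intro s hs
    rw [uIcc_of_le ht.1.le] at hs
    simp only [e0 s hs.2, mul_comm]
  have i2 : ∫ s in (0 : ℝ)..t,
        (∫ x, u s x ∂μ) * (deriv (deriv k) s - 0 - b * deriv k s + m ^ 2 * k s) =
      ∫ s in (0 : ℝ)..t, (a'' s - b * a' s + m ^ 2 * a s) * ∫ x, u s x ∂μ := by
    apply intervalIntegral.integral_congr
    intro s hs
    rw [uIcc_of_le ht.1.le] at hs
    simp only [e0 s hs.2, e1 s hs.2, e2 s hs.2, sub_zero, mul_comm]
  rw [i1, i2] at key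
  rw [key]
  ring

theorem mean_v (h : IsEnergySolution g μ b m p q ε u₀ u₁ v₀ v₁ T u v) {t : ℝ}
    (ht : t ∈ Ioo 0 T) :
    ∫ x, v t x ∂μ = ε * ∫ x, v₀ x ∂μ + ε * (∫ x, v₁ x ∂μ) * t
      + ∫ s in (0 : ℝ)..t, (t - s) * ∫ x, |u s x| ^ q ∂μ := by
  obtain ⟨k, hk, hka⟩ := exists_timeTest (n := n) (G := G) ht.2
    (contDiff_const.sub contDiff_id : ContDiff ℝ ∞ fun s : ℝ => t - s)
  have hd : ∀ s, HasDerivAt (fun s : ℝ => t - s) (-1) s := fun s => by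
    simpa using (hasDerivAt_id s).const_sub t
  have e0 : ∀ s ≤ t, k s = t - s := fun s hs => (hka s hs).self_of_nhds
  have e1 : ∀ s ≤ t, deriv k s = -1 := fun s hs => by
    rw [(hka s hs).deriv_eq]; exact (hd s).deriv
  have e2 : ∀ s ≤ t, deriv (deriv k) s = 0 := fun s hs => by
    rw [(hka s hs).deriv.deriv_eq]
    have : deriv (fun s : ℝ => t - s) = fun _ => -1 := funext fun s => (hd s).deriv
    rw [this, deriv_const]
  have key := h.eq_v _ hk t ht
  have d1 : ∀ s x, dt (fun s (_ : G) => k s) s x = deriv k s := fun _ _ => rfl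
  have d2 : ∀ s x, dt (dt (fun s (_ : G) => k s)) s x = deriv (deriv k) s := fun _ _ => rfl
  simp only [d1, d2, laplaceBeltrami_const, integral_mul_const] at key
  rw [e0 t le_rfl, e1 t le_rfl, e0 0 ht.1.le, e1 0 ht.1.le] at key
  have i1 : ∫ s in (0 : ℝ)..t, (∫ x, |u s x| ^ q ∂μ) * k s =
      ∫ s in (0 : ℝ)..t, (t - s) * ∫ x, |u s x| ^ q ∂μ := by
    apply intervalIntegral.integral_congr
    intro s hs
    rw [uIcc_of_le ht.1.le] at hs
    simp only [e0 s hs.2, mul_comm]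
  have i2 : ∫ s in (0 : ℝ)..t, (∫ x, v s x ∂μ) * (deriv (deriv k) s - 0) = 0 := by
    rw [intervalIntegral.integral_congr (g := fun _ => 0)]
    · simp
    · intro s hs
      rw [uIcc_of_le ht.1.le] at hs
      simp [e2 s hs.2]
  rw [i1, i2] at key
  rw [key]
  ring

end IsEnergySolution

/-! ### Jensen's inequality and the averaged system of an energy solution -/

theorem abs_integral_rpow_le {Ω : Type*} [MeasurableSpace Ω] {μ : Measure Ω}
    [IsProbabilityMeasure μ] {r : ℝ} (hr : 1 ≤ r) {f : Ω → ℝ} (hf : Integrable f μ)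
    (hfr : Integrable (fun x => |f x| ^ r) μ) :
    |∫ x, f x ∂μ| ^ r ≤ ∫ x, |f x| ^ r ∂μ := by
  have h1 : |∫ x, f x ∂μ| ≤ ∫ x, |f x| ∂μ := abs_integral_le_integral_abs
  refine (Real.rpow_le_rpow (abs_nonneg _) h1 (by linarith)).trans ?_
  exact (convexOn_rpow hr).map_integral_le
    (continuousOn_id.rpow_const fun _ _ => Or.inr (by linarith)) isClosed_Ici
    (Filter.Eventually.of_forall fun x => abs_nonneg (f x)) hf.abs hfr

theorem integral_Lp_nonneg {Ω : Type*} [MeasurableSpace Ω] {μ : Measure Ω} {f : Lp ℝ 2 μ}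
    (hf : 0 ≤ f) : 0 ≤ ∫ x, f x ∂μ :=
  integral_nonneg_of_ae ((Lp.coeFn_nonneg f).2 hf)

theorem integral_Lp_pos {Ω : Type*} [MeasurableSpace Ω] {μ : Measure Ω} [IsFiniteMeasure μ]
    {f : Lp ℝ 2 μ} (hf : 0 ≤ f) (hf0 : f ≠ 0) : 0 < ∫ x, f x ∂μ := by
  refine (integral_Lp_nonneg hf).lt_of_ne fun h => hf0 ?_
  rw [eq_comm, integral_eq_zero_iff_of_nonneg_ae ((Lp.coeFn_nonneg f).2 hf)
    ((Lp.memLp f).integrable one_le_two)] at h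
  exact (Lp.eq_zero_iff_ae_eq_zero).2 h

theorem MemLrLoc.abs_integral_rpow_le {G : Type*} [MeasurableSpace G] {μ : Measure G}
    [IsProbabilityMeasure μ] {T r : ℝ} (hr : 1 ≤ r) {u : ℝ → Lp ℝ 2 μ} (hu : MemLrLoc μ T r u)
    {t : ℝ} (ht : t ∈ Ioo 0 T) :
    ∀ᵐ s ∂volume.restrict (Ioc 0 t), |∫ x, u s x ∂μ| ^ r ≤ ∫ x, |u s x| ^ r ∂μ := by
  filter_upwards [(hu t ht).1] with s hs
  exact CompactLieWave.abs_integral_rpow_le hr ((Lp.memLp (u s)).integrable one_le_two) hs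

theorem IsEnergySolution.averagedSystem [IsManifold (𝓡 n) 1 G] {g : RiemMetric n G}
    {μ : Measure G} [IsProbabilityMeasure μ] {b m p q ε : ℝ} {u₀ u₁ v₀ v₁ : Lp ℝ 2 μ} {T : ℝ}
    {u v : ℝ → Lp ℝ 2 μ} (h : IsEnergySolution g μ b m p q ε u₀ u₁ v₀ v₁ T u v)
    (hb : 0 < b) (hbm : 4 * m ^ 2 ≤ b ^ 2) (hp : 1 ≤ p) (hq : 1 ≤ q) (hε : 0 ≤ ε)
    (hu₀ : 0 ≤ u₀) (hu₁ : 0 ≤ u₁) (hv₁ : 0 ≤ v₁) :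
    ∃ K : ℝ → ℝ, AveragedSystem p q (Real.exp (-(b / 2))) (ε * ∫ x, v₀ x ∂μ)
      (ε * ∫ x, v₁ x ∂μ) T K (fun s => ∫ x, |u s x| ^ q ∂μ) (fun s => ∫ x, |v s x| ^ p ∂μ)
      (fun s => ∫ x, u s x ∂μ) (fun s => ∫ x, v s x ∂μ) := by
  obtain ⟨K, K', hK, hK0, hK'0, hKd, hKd', hKnn, hKb, hKe⟩ := exists_damped_kernel hb hbm
  have hU₀ := integral_Lp_nonneg hu₀
  have hU₁ := integral_Lp_nonneg hu₁
  refine ⟨K, ⟨mul_nonneg hε (integral_Lp_nonneg hv₁), fun s => integral_nonneg fun x => by positivity,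
    fun s => integral_nonneg fun x => by positivity, fun t ht => ?_, fun t ht => ?_, hK.continuous,
    hKnn, hKe, fun t ht => h.mean_v ht, fun t ht => ?_,
    fun t ht => h.u_Lq.abs_integral_rpow_le hq ht,
    fun t ht => h.v_Lp.abs_integral_rpow_le hp ht⟩⟩
  · exact (intervalIntegrable_iff_integrableOn_Ioc_of_le ht.1.le).2 (h.u_Lq t ht).2
  · exact (intervalIntegrable_iff_integrableOn_Ioc_of_le ht.1.le).2 (h.v_Lp t ht).2
  · have hsub : ∀ s, HasDerivAt (fun s : ℝ => t - s) (-1) s := fun s => by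
      simpa using (hasDerivAt_id s).const_sub t
    -- The time-reversed kernel solves the adjoint equation `a'' - b a' + m² a = 0`, so the last
    -- integral vanishes; `a 0 = K t`, `a' 0 = -K' t` and `a' t = -1` isolate the mean of `u` at
    -- `t`.
    have key := h.mean_u ht (a := fun s => K (t - s)) (a' := fun s => -K' (t - s))
      (a'' := fun s => -b * K' (t - s) - m ^ 2 * K (t - s))
      (hK.comp (contDiff_const.sub contDiff_id))
      (fun s => ((hKd (t - s)).comp s (hsub s)).congr_deriv (by ring))
      (fun s => ((hKd' (t - s)).comp s (hsub s)).neg.congr_deriv (by ring))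
      (by simp [hK0])
    have h0 : ∀ s, -b * K' (t - s) - m ^ 2 * K (t - s) - b * -K' (t - s) + m ^ 2 * K (t - s) = 0 :=
      fun s => by ring
    simp only [h0, zero_mul, intervalIntegral.integral_zero, sub_self, hK'0, sub_zero] at key
    rw [key]
    have h1 := mul_nonneg (mul_nonneg hε (hKnn t ht.1.le)) hU₁
    have h2 := mul_nonneg (mul_nonneg hε (hKb t ht.1.le)) hU₀
    linarith

end CompactLieWave

/-! ### The lifespan estimate -/

theorem theorem2p1 {n : ℕ} {G : Type*} [TopologicalSpace G] [T2Space G] [CompactSpace G]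
    [ChartedSpace (EuclideanSpace ℝ (Fin n)) G] [Group G] [LieGroup (𝓡 n) ∞ G]
    (g : CompactLieWave.RiemMetric n G) (hg : CompactLieWave.IsBiInvariant g)
    [MeasurableSpace G] [BorelSpace G]
    (μ : Measure G) [μ.IsHaarMeasure] [IsProbabilityMeasure μ]
    (b m p q : ℝ) (hb : 0 < b) (hm : 0 < m ^ 2) (hbm : 4 * m ^ 2 ≤ b ^ 2)
    (hp : 1 < p) (hq : 1 < q)
    (u₀ u₁ v₀ v₁ : Lp ℝ 2 μ)
    (hu₀H : CompactLieWave.MemH1 g μ u₀) (hv₀H : CompactLieWave.MemH1 g μ v₀)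
    (hu₀ : 0 ≤ u₀) (hu₁ : 0 ≤ u₁) (hv₀ : 0 ≤ v₀) (hv₁ : 0 ≤ v₁)
    (hu : u₀ ≠ 0 ∨ u₁ ≠ 0) (hv : v₀ ≠ 0 ∨ v₁ ≠ 0) :
    ∃ ε₀ C : ℝ, 0 < ε₀ ∧ 0 < C ∧
      ∀ ε : ℝ, 0 < ε → ε ≤ ε₀ →
        ∀ u v : ℝ → Lp ℝ 2 μ,
          (∃ T : ℝ, 0 < T ∧
            CompactLieWave.IsEnergySolution g μ b m p q ε u₀ u₁ v₀ v₁ T u v) →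
          CompactLieWave.lifespan g μ b m p q ε u₀ u₁ v₀ v₁ u v < ⊤ ∧
          (v₁ ≠ 0 → CompactLieWave.lifespan g μ b m p q ε u₀ u₁ v₀ v₁ u v ≤
            ENNReal.ofReal (C * ε ^ (-((p * q - 1) / (p * q + 1))))) ∧
          (v₁ = 0 → CompactLieWave.lifespan g μ b m p q ε u₀ u₁ v₀ v₁ u v ≤
            ENNReal.ofReal (C * ε ^ (-((p * q - 1) / 2)))) := by
  obtain ⟨C₁, C₂, hC₁, hC₂, hbound⟩ :=
    CompactLieWave.exists_averagedSystem_bound hp hq (Real.exp_pos (-(b / 2)))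
  have hκ : 0 < p * q - 1 := by nlinarith
  have hV₀ := CompactLieWave.integral_Lp_nonneg hv₀
  have hV₁ := CompactLieWave.integral_Lp_nonneg hv₁
  set V₀ := ∫ x, v₀ x ∂μ
  set V₁ := ∫ x, v₁ x ∂μ
  have main : ∀ ε : ℝ, 0 < ε → ∀ u v T,
      CompactLieWave.IsEnergySolution g μ b m p q ε u₀ u₁ v₀ v₁ T u v → ∀ t₀ A : ℝ, 0 < t₀ →
      0 < A → A ≤ ε * V₀ + ε * V₁ * t₀ → T ≤ t₀ + C₁ + C₂ * A ^ (-((p * q - 1) / 2)) := by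
    intro ε hε u v T h t₀ A ht₀ hA hAV
    obtain ⟨K, hK⟩ := h.averagedSystem hb hbm hp.le hq.le hε.le hu₀ hu₁ hv₁
    exact hbound _ _ _ _ _ _ _ _ hK t₀ A ht₀ hA fun ht => hAV.trans (hK.le_V ht₀ ht)
  have hone : ∀ ε : ℝ, 0 < ε → ε ≤ 1 → ∀ r : ℝ, 0 < r → 1 ≤ ε ^ (-r) := fun ε hε hε1 r hr =>
    Real.one_le_rpow_of_pos_of_le_one_of_nonpos hε hε1 (by linarith)
  have b₁ : v₁ ≠ 0 → ∀ ε : ℝ, 0 < ε → ε ≤ 1 → ∀ u v T,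
      CompactLieWave.IsEnergySolution g μ b m p q ε u₀ u₁ v₀ v₁ T u v →
      T ≤ (1 + C₁ + C₂ * V₁ ^ (-((p * q - 1) / 2))) * ε ^ (-((p * q - 1) / (p * q + 1))) := by
    intro hv₁0 ε hε hε1 u v T h
    have hV₁p : 0 < V₁ := CompactLieWave.integral_Lp_pos hv₁ hv₁0
    have hE := hone ε hε hε1 ((p * q - 1) / (p * q + 1)) (by positivity)
    set E := ε ^ (-((p * q - 1) / (p * q + 1)))
    -- With `A = ε V₁ t₀`, the waiting time `t₀` and the term `A ^ (-((p * q - 1) / 2))` have the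
    -- same order in `ε` exactly when `t₀` is of order `E`.
    have h1 := main ε hε u v T h E (ε * V₁ * E) (by positivity) (by positivity)
      (le_add_of_nonneg_left (by positivity))
    have h2 : (ε * V₁ * E) ^ (-((p * q - 1) / 2)) = V₁ ^ (-((p * q - 1) / 2)) * E := by
      rw [show ε * V₁ * E = V₁ * (ε * E) by ring, Real.mul_rpow hV₁p.le (by positivity)]
      congr 1
      nth_rw 1 [← Real.rpow_one ε]
      rw [← Real.rpow_add hε, ← Real.rpow_mul hε.le]
      congr 1
      field_simp
      ring
    rw [h2] at h1
    have h3 := mul_le_mul_of_nonneg_left hE hC₁.le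
    linarith
  have b₂ : v₁ = 0 → ∀ ε : ℝ, 0 < ε → ε ≤ 1 → ∀ u v T,
      CompactLieWave.IsEnergySolution g μ b m p q ε u₀ u₁ v₀ v₁ T u v →
      T ≤ (1 + C₁ + C₂ * V₀ ^ (-((p * q - 1) / 2))) * ε ^ (-((p * q - 1) / 2)) := by
    intro hv₁0 ε hε hε1 u v T h
    have hV₀p : 0 < V₀ :=
      CompactLieWave.integral_Lp_pos hv₀ (hv.resolve_right (not_not.2 hv₁0))
    have hE := hone ε hε hε1 ((p * q - 1) / 2) (by positivity)
    -- Without linear growth from `v₁`, waiting brings nothing, so `t₀ = 1` and `A` comes from `v₀`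
    -- alone.
    have h1 := main ε hε u v T h 1 (ε * V₀) one_pos (by positivity)
      (le_add_of_nonneg_right (by positivity))
    rw [Real.mul_rpow hε.le hV₀p.le] at h1
    set E := ε ^ (-((p * q - 1) / 2))
    have h3 := mul_le_mul_of_nonneg_left hE hC₁.le
    linarith
  have hD₁ : 0 ≤ V₁ ^ (-((p * q - 1) / 2)) := by positivity
  have hD₂ : 0 ≤ V₀ ^ (-((p * q - 1) / 2)) := by positivity
  set D₁ := V₁ ^ (-((p * q - 1) / 2))
  set D₂ := V₀ ^ (-((p * q - 1) / 2))
  -- For `ε ≤ 1` the negative powers of `ε` are at least `1` and absorb the additive constants; the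
  -- sum of both prefactors covers both cases.
  refine ⟨1, 1 + C₁ + C₂ * D₁ + C₂ * D₂, one_pos, by positivity, fun ε hε hε1 u v _ => ?_⟩
  have c₁ : v₁ ≠ 0 → CompactLieWave.lifespan g μ b m p q ε u₀ u₁ v₀ v₁ u v ≤ ENNReal.ofReal
      ((1 + C₁ + C₂ * D₁ + C₂ * D₂) * ε ^ (-((p * q - 1) / (p * q + 1)))) := fun hv₁0 =>
    iSup₂_le fun τ hτ => ENNReal.ofReal_le_ofReal <|
      (b₁ hv₁0 ε hε hε1 u v τ hτ.2).trans <| by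
        refine mul_le_mul_of_nonneg_right ?_ (by positivity)
        linarith [mul_nonneg hC₂.le hD₁, mul_nonneg hC₂.le hD₂]
  have c₂ : v₁ = 0 → CompactLieWave.lifespan g μ b m p q ε u₀ u₁ v₀ v₁ u v ≤ ENNReal.ofReal
      ((1 + C₁ + C₂ * D₁ + C₂ * D₂) * ε ^ (-((p * q - 1) / 2))) := fun hv₁0 =>
    iSup₂_le fun τ hτ => ENNReal.ofReal_le_ofReal <|
      (b₂ hv₁0 ε hε hε1 u v τ hτ.2).trans <| by
        refine mul_le_mul_of_nonneg_right ?_ (by positivity)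
        linarith [mul_nonneg hC₂.le hD₁, mul_nonneg hC₂.le hD₂]
  refine ⟨?_, c₁, c₂⟩
  by_cases hv₁0 : v₁ = 0
  · exact (c₂ hv₁0).trans_lt ENNReal.ofReal_lt_top
  · exact (c₁ hv₁0).trans_lt ENNReal.ofReal_lt_top
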